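/- Let $V$ be a finite-dimensional real vector space, and let $\mathcal{K}(V)$ be the set of convex bodies (nonempty compact convex subsets) of $V$, with the topology of the Hausdorff metric induced by any norm on $V$. A function $\varphi\colon\mathcal{K}(V)\to A$ into an abelian group $A$ is called a valuation if $\varphi(B\cup C)=\varphi(B)+\varphi(C)-\varphi(B\cap C)$ for all $B,C\in\mathcal{K}(V)$ with $B\cup C\in\mathcal{K}(V)$, and translation-invariant if $\varphi(x+K)=\varphi(K)$ for all $x\in V$ and $K\in\mathcal{K}(V)$. Let $\varphi\colon\mathcal{K}(V)\to A$ be a continuous translation-invariant valuation with values in a Hausdorff topological abelian group $A$. Then $\varphi$ takes the same value $c\in A$ on all one-point convex bodies, and there are a real Hausdorff topological vector space $\mathcal{V}$, a continuous translation-invariant valuation $f\colon\mathcal{K}(V)\to\mathcal{V}$ and a continuous group homomorphism $g\colon\mathcal{V}\to A$ such that \[ \varphi(X)-c=g(f(X))\qquad\text{for all }X\in\mathcal{K}(V). \] -/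

import Mathlib

universe u v

namespace ConvexBody

variable {V : Type*} [TopologicalSpace V] [AddCommGroup V] [Module ℝ V]

/-- The one-point convex body `{x}`. -/
def point (x : V) : ConvexBody V where
  carrier := {x}
  convex' := convex_singleton x
  isCompact' := isCompact_singleton
  nonempty' := Set.singleton_nonempty x

/-- The translate `x + K` of a convex body `K`. -/
def translate [ContinuousAdd V] (x : V) (K : ConvexBody V) : ConvexBody V where
  carrier := (fun y => x + y) '' (K : Set V)
  convex' := K.convex.translate x
  isCompact' := K.isCompact.image (continuous_const.add continuous_id)
  nonempty' := K.nonempty.image _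

/-- A function `φ` on convex bodies with values in an abelian group is a valuation if
`φ (B ∪ C) = φ B + φ C - φ (B ∩ C)` whenever `B`, `C` and `B ∪ C` are convex bodies. Here `U` is
the convex body `B ∪ C` and `I` is the convex body `B ∩ C`; the latter always exists in a Hausdorff
space, because a convex set is connected and so is not the union of two disjoint nonempty
compact sets. -/
def IsValuation {A : Type*} [AddCommGroup A] (φ : ConvexBody V → A) : Prop :=
  ∀ B C U I : ConvexBody V, (U : Set V) = (B : Set V) ∪ (C : Set V) →
    (I : Set V) = (B : Set V) ∩ (C : Set V) → φ U = φ B + φ C - φ I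

/-- `φ (x + K) = φ K` for every vector `x` and every convex body `K`. -/
def IsTranslationInvariant [ContinuousAdd V] {A : Type*} (φ : ConvexBody V → A) : Prop :=
  ∀ (x : V) (K : ConvexBody V), φ (translate x K) = φ K

end ConvexBody

section SetValuation

/-! ### Valuations as set functions: linear images, cones and cuts. -/

open Set

variable {V V' A : Type*} [NormedAddCommGroup V] [NormedSpace ℝ V] [NormedAddCommGroup V']
  [NormedSpace ℝ V'] [AddCommGroup A]

/-- A set function vanishing on the empty set and satisfying the valuation identity on nonempty
compact convex sets with convex union. -/
structure IsSetValuation (θ : Set V → A) : Prop where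
  empty : θ ∅ = 0
  union : ∀ B C : Set V, B.Nonempty → C.Nonempty → Convex ℝ B → Convex ℝ C → IsCompact B →
    IsCompact C → Convex ℝ (B ∪ C) → θ (B ∪ C) = θ B + θ C - θ (B ∩ C)

/-- A convex set is connected, so two nonempty closed sets cannot cover it disjointly. -/
theorem Convex.inter_nonempty_of_union {B C : Set V} (hB : B.Nonempty) (hC : C.Nonempty)
    (hBc : IsClosed B) (hCc : IsClosed C) (h : Convex ℝ (B ∪ C)) : (B ∩ C).Nonempty := by
  have := isPreconnected_closed_iff.1 h.isPreconnected B C hBc hCc subset_rfl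
    (by simpa using hB.mono (by simp)) (by simpa using hC.mono (by simp))
  exact this.mono inter_subset_right

/-- A linear image of the intersection of two closed sets with convex union is the intersection
of the images. -/
theorem Convex.image_inter_of_union {B C : Set V'} (L : V' →ᵃ[ℝ] V) (hL : Continuous L)
    (hBc : IsClosed B) (hCc : IsClosed C) (h : Convex ℝ (B ∪ C)) :
    L '' (B ∩ C) = L '' B ∩ L '' C := by
  refine (image_inter_subset _ _ _).antisymm ?_
  rintro y ⟨⟨b, hb, rfl⟩, c, hc, hbc⟩
  have hF : IsClosed (L ⁻¹' {L b}) := isClosed_singleton.preimage hL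
  -- Within the fibre over the common image point the union is still convex, so `B` and `C` meet
  -- inside that fibre.
  have hconv : Convex ℝ ((B ∩ L ⁻¹' {L b}) ∪ (C ∩ L ⁻¹' {L b})) := by
    rw [← union_inter_distrib_right]
    exact h.inter ((convex_singleton _).affine_preimage L)
  obtain ⟨z, hz⟩ := Convex.inter_nonempty_of_union (B := B ∩ L ⁻¹' {L b})
    (C := C ∩ L ⁻¹' {L b}) ⟨b, hb, rfl⟩ ⟨c, hc, hbc⟩
    (hBc.inter hF) (hCc.inter hF) hconv
  exact ⟨z, ⟨hz.1.1, hz.2.1⟩, hz.1.2⟩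

/-- The push-forward of a set valuation under a continuous affine map. -/
theorem IsSetValuation.image {θ : Set V → A} (hθ : IsSetValuation θ) (L : V' →ᵃ[ℝ] V)
    (hL : Continuous L) : IsSetValuation fun K : Set V' => θ (L '' K) where
  empty := by simp [hθ.empty]
  union B C hB hC hBc hCc hBk hCk h := by
    rw [Convex.image_inter_of_union L hL hBk.isClosed hCk.isClosed h, image_union]
    refine hθ.union _ _ (hB.image _) (hC.image _) (hBc.affine_image L) (hCc.affine_image L)
      (hBk.image hL) (hCk.image hL) ?_
    rw [← image_union]
    exact h.affine_image L

theorem IsCompact.convexJoin_singleton {K : Set V} (hK : IsCompact K) (p : V) :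
    IsCompact (convexJoin ℝ {p} K) := by
  have : convexJoin ℝ {p} K = (fun z : ℝ × V => (1 - z.1) • p + z.1 • z.2) '' (Icc 0 1 ×ˢ K) := by
    ext x
    simp only [convexJoin_singleton_left, mem_iUnion, segment_eq_image, mem_image, Prod.exists,
      mem_prod, exists_prop]
    constructor
    · rintro ⟨y, hy, t, ht, rfl⟩
      exact ⟨t, y, ⟨ht, hy⟩, rfl⟩
    · rintro ⟨t, y, ⟨ht, hy⟩, rfl⟩
      exact ⟨y, hy, t, ht, rfl⟩
  rw [this]
  exact (isCompact_Icc.prod hK).image (by fun_prop)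

/-- Cones with apex `p` over sets in an affine hyperplane not containing `p` intersect in the cone
over the intersection. -/
theorem convexJoin_inter_of_hyperplane {g : V →ᵃ[ℝ] ℝ} {p : V} (hp : g p ≠ 0) {B C : Set V}
    (hB : ∀ x ∈ B, g x = 0) (hC : ∀ x ∈ C, g x = 0) (hBC : (B ∩ C).Nonempty) :
    convexJoin ℝ {p} (B ∩ C) = convexJoin ℝ {p} B ∩ convexJoin ℝ {p} C := by
  refine (subset_inter (convexJoin_mono_right inter_subset_left)
    (convexJoin_mono_right inter_subset_right)).antisymm ?_
  rintro x ⟨hxB, hxC⟩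
  simp only [convexJoin_singleton_left, mem_iUnion, segment_eq_image_lineMap, exists_prop]
    at hxB hxC ⊢
  obtain ⟨b, hb, t, ht, rfl⟩ := hxB
  obtain ⟨c, hc, s, hs, hsc⟩ := hxC
  -- On the segment from `p` to a zero of `g`, `g` equals `(1 - t) * g p`, so the parameter is
  -- determined by the point.
  have hst : s = t := by
    have := congrArg g hsc
    rw [AffineMap.apply_lineMap, AffineMap.apply_lineMap, hB b hb, hC c hc] at this
    simp only [AffineMap.lineMap_apply, vsub_eq_sub, smul_eq_mul, vadd_eq_add, zero_sub] at this
    exact mul_right_cancel₀ hp (by linarith)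
  subst hst
  rcases eq_or_ne s 0 with rfl | h0
  · obtain ⟨z, hz⟩ := hBC
    exact ⟨z, hz, 0, ht, by simp⟩
  · have : c = b := by
      simp only [AffineMap.lineMap_apply, vsub_eq_sub, vadd_eq_add, add_left_inj] at hsc
      exact sub_left_injective (smul_right_injective V h0 hsc)
    subst this
    exact ⟨c, ⟨hb, hc⟩, s, ht, rfl⟩

/-- The set valuation obtained by forming cones over subsets of a hyperplane. -/
theorem IsSetValuation.cone {θ : Set V → A} (hθ : IsSetValuation θ) (L : V' →ᵃ[ℝ] V)
    (hL : Continuous L) {g : V →ᵃ[ℝ] ℝ} {p : V} (hp : g p ≠ 0) (hg : ∀ x, g (L x) = 0) :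
    IsSetValuation fun K : Set V' => θ (convexJoin ℝ {p} (L '' K)) where
  empty := by simp [hθ.empty]
  union B C hB hC hBc hCc hBk hCk h := by
    have hne := Convex.inter_nonempty_of_union hB hC hBk.isClosed hCk.isClosed h
    have hinter := Convex.image_inter_of_union L hL hBk.isClosed hCk.isClosed h
    have hcone : ∀ S : Set V', Convex ℝ S → Convex ℝ (convexJoin ℝ {p} (L '' S)) :=
      fun S hS => (convex_singleton p).convexJoin (hS.affine_image L)
    have hz : ∀ S : Set V', ∀ x ∈ L '' S, g x = 0 := by
      rintro S _ ⟨x, _, rfl⟩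
      exact hg x
    have hne' : ∀ S : Set V', S.Nonempty → (convexJoin ℝ {p} (L '' S)).Nonempty := fun S hS =>
      (hS.image L).mono (subset_convexJoin_right (singleton_nonempty p))
    rw [hinter, convexJoin_inter_of_hyperplane hp (hz B) (hz C) (hinter ▸ hne.image L),
      image_union, convexJoin_union_right]
    refine hθ.union _ _ (hne' B hB) (hne' C hC) (hcone B hBc) (hcone C hCc)
      ((hBk.image hL).convexJoin_singleton p) ((hCk.image hL).convexJoin_singleton p) ?_
    rw [← convexJoin_union_right, ← image_union]
    exact hcone _ h

/-- Cutting a compact convex set along a hyperplane. -/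
theorem IsSetValuation.cut [FiniteDimensional ℝ V] {θ : Set V → A} (hθ : IsSetValuation θ)
    (g : V →ᵃ[ℝ] ℝ) {K : Set V} (hK : Convex ℝ K) (hKc : IsCompact K) :
    θ K = θ (K ∩ {x | g x ≤ 0}) + θ (K ∩ {x | 0 ≤ g x}) - θ (K ∩ {x | g x = 0}) := by
  have hg : Continuous g := g.continuous_of_finiteDimensional
  have hunion : K ∩ {x | g x ≤ 0} ∪ K ∩ {x | 0 ≤ g x} = K := by
    rw [← inter_union_distrib_left]
    exact inter_eq_left.2 fun x _ => le_total (g x) 0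
  have hinter : (K ∩ {x | g x ≤ 0}) ∩ (K ∩ {x | 0 ≤ g x}) = K ∩ {x | g x = 0} := by
    ext x
    simp only [mem_inter_iff, mem_ofPred_eq]
    constructor
    · rintro ⟨⟨h, h1⟩, -, h2⟩
      exact ⟨h, le_antisymm h1 h2⟩
    · rintro ⟨h, h1⟩
      exact ⟨⟨h, h1.le⟩, h, h1.ge⟩
  -- If one side is empty, the formula rests on the convention `θ ∅ = 0`.
  rcases (K ∩ {x | g x ≤ 0}).eq_empty_or_nonempty with h1 | h1
  · rw [h1, empty_union] at hunion
    rw [← hinter, h1, hunion, empty_inter, hθ.empty]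
    abel
  rcases (K ∩ {x | 0 ≤ g x}).eq_empty_or_nonempty with h2 | h2
  · rw [h2, union_empty] at hunion
    rw [← hinter, h2, hunion, inter_empty, hθ.empty]
    abel
  conv_lhs => rw [← hunion]
  rw [← hinter]
  refine hθ.union _ _ h1 h2 (hK.inter ((convex_Iic (0 : ℝ)).affine_preimage g))
    (hK.inter ((convex_Ici (0 : ℝ)).affine_preimage g))
    (hKc.inter_right (isClosed_le hg continuous_const))
    (hKc.inter_right (isClosed_le continuous_const hg)) ?_
  rwa [hunion]

end SetValuation

/-! ### Continuous polynomial maps and one-parameter groups. -/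

section ContinuousPolynomial

open Function fwdDiff
open scoped NNReal

section Algebra

variable {M G : Type*} [AddCommMonoid M] [AddCommGroup G]

theorem fwdDiff_commute (a b : M) : Function.Commute (fwdDiff (G := G) a) (fwdDiff b) := by
  intro f
  funext y
  simp only [fwdDiff, add_right_comm y a b]
  abel

theorem fwdDiff_zero_step (f : M → G) : Δ_[(0 : M)] f = 0 := by
  funext y
  simp [fwdDiff]

theorem fwdDiff_zero_fun (h : M) : Δ_[h] (0 : M → G) = 0 := by
  funext y
  simp [fwdDiff]

/-- `Δ_[e] f` is `e`-periodic, and the difference with step `a • e` telescopes into `a` of its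
shifts. -/
theorem fwdDiff_nsmul_eq {e : M} {f : M → G} (hf : Δ_[e] (Δ_[e] f) = 0) (a : ℕ) :
    Δ_[a • e] f = a • Δ_[e] f := by
  have hper : ∀ (j : ℕ) (y : M), Δ_[e] f (y + j • e) = Δ_[e] f y := by
    intro j y
    induction j with
    | zero => simp
    | succ j ih =>
      have := congrFun hf (y + j • e)
      rw [fwdDiff, Pi.zero_apply, sub_eq_zero] at this
      rw [succ_nsmul, ← add_assoc, this, ih]
  induction a with
  | zero => rw [zero_nsmul, zero_nsmul, fwdDiff_zero_step]
  | succ a ih =>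
    funext y
    have h1 := congrFun ih y
    have h2 := hper a y
    simp only [Pi.smul_apply] at h1 ⊢
    rw [succ_nsmul (Δ_[e] f y) a, ← h1, ← h2]
    simp only [fwdDiff, succ_nsmul, ← add_assoc]
    abel

theorem fwdDiff_iter_nsmul_eq {e : M} (k : ℕ) {f : M → G} (hf : Δ_[e] ^[k + 1] f = 0) (b : ℕ) :
    Δ_[b • e] ^[k] f = b ^ k • Δ_[e] ^[k] f := by
  induction k generalizing f with
  | zero => simp
  | succ k ih =>
    have h1 : Δ_[b • e] (Δ_[e] ^[k] f) = b • Δ_[e] (Δ_[e] ^[k] f) := by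
      apply fwdDiff_nsmul_eq
      rw [← iterate_succ_apply' (fwdDiff e), ← iterate_succ_apply' (fwdDiff e), hf]
    have h2 : Δ_[b • e] (Δ_[e] ^[k + 1] f) = 0 := by
      rw [fwdDiff_nsmul_eq, ← iterate_succ_apply' (fwdDiff e), hf, smul_zero]
      rw [← iterate_succ_apply' (fwdDiff e), hf, fwdDiff_zero_fun]
    have comm := fun j => ((fwdDiff_commute (G := G) (b • e) e).iterate_right j).eq f
    rw [iterate_succ_apply, ih (by rw [← comm, h2]), ← comm, h1, iterate_succ_apply', smul_smul,
      pow_succ]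

/-- Linearity in `a` is the point: with `e = 1 / N` and `b = N` this makes the `k`-th unit
difference additive along the grid of mesh `1 / N`. -/
theorem fwdDiff_nsmul_iter_nsmul {e : M} (k : ℕ) {f : M → G} (hf : Δ_[e] ^[k + 2] f = 0)
    (a b : ℕ) : Δ_[a • e] (Δ_[b • e] ^[k] f) = (a * b ^ k) • Δ_[e] ^[k + 1] f := by
  have comm := fun j => ((fwdDiff_commute (G := G) (a • e) e).iterate_right j).eq f
  have h0 : Δ_[e] (Δ_[e] ^[k + 1] f) = 0 := by rw [← iterate_succ_apply' (fwdDiff e), hf]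
  have h2 : Δ_[a • e] (Δ_[e] ^[k + 1] f) = 0 := by
    rw [fwdDiff_nsmul_eq, h0, smul_zero]
    rw [h0, fwdDiff_zero_fun]
  rw [((fwdDiff_commute (G := G) (a • e) (b • e)).iterate_right k).eq f,
    fwdDiff_iter_nsmul_eq k (by rw [← comm, h2]), ← comm, fwdDiff_nsmul_eq, smul_smul,
    iterate_succ_apply', mul_comm]
  rw [← iterate_succ_apply' (fwdDiff e), h0]

/-- With `S` the group of invariant valuations, this keeps every difference of the dilates an
invariant valuation. -/
theorem fwdDiff_iter_mem {S : AddSubgroup G} {f : M → G} (hf : ∀ y, f y ∈ S) (h : M) (k : ℕ)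
    (y : M) : Δ_[h] ^[k] f y ∈ S := by
  induction k generalizing y with
  | zero => exact hf y
  | succ k ih =>
    rw [iterate_succ_apply']
    exact S.sub_mem (ih _) (ih _)

end Algebra

/-- Rescaling reduces to unit step, the case `h = 0` being separate. Used to see that `t ↦ B (t ^ n
/ n!)` has `n`-th difference `B (h ^ n)`. -/
theorem fwdDiff_iter_pow_real (n : ℕ) (y h : ℝ) :
    ∑ k ∈ Finset.range (n + 1), ((-1 : ℤ) ^ (n - k) * n.choose k) • (y + k * h) ^ n
      = n.factorial * h ^ n := by
  rcases eq_or_ne h 0 with rfl | hh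
  · rcases n.eq_zero_or_pos with rfl | hn
    · simp
    · have := fwdDiff_iter_eq_sum_shift (0 : ℝ) (fun r : ℝ => r ^ n) n y
      obtain ⟨m, rfl⟩ := Nat.exists_eq_succ_of_ne_zero hn.ne'
      rw [iterate_succ_apply', fwdDiff_zero_step] at this
      simp only [smul_zero, add_zero, Pi.zero_apply] at this
      simp only [mul_zero, add_zero]
      rw [← this, zero_pow (by simp), mul_zero]
  · have h1 := fwdDiff_iter_eq_sum_shift (1 : ℝ) (fun r : ℝ => r ^ n) n (y / h)
    rw [fwdDiff_iter_eq_factorial] at h1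
    have h2 : ((n.factorial : ℝ → ℝ) (y / h)) = (n.factorial : ℝ) := rfl
    rw [h2] at h1
    rw [h1, Finset.sum_mul]
    refine Finset.sum_congr rfl fun k _ => ?_
    rw [smul_mul_assoc, ← mul_pow]
    congr 2
    simp only [nsmul_eq_mul, mul_one]
    field_simp


theorem NNReal.dense_grid : Dense {x : ℝ≥0 | ∃ (N a : ℕ), 0 < N ∧ x = a / N} := by
  intro x
  rw [mem_closure_iff_nhds_basis Metric.nhds_basis_ball]
  intro ε hε
  obtain ⟨N, hN⟩ := exists_nat_gt (ε⁻¹ : ℝ)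
  have hN0 : (0 : ℝ) < N := (inv_pos.2 hε).trans hN
  have hN1 : (0 : ℝ≥0) < N := by exact_mod_cast hN0
  refine ⟨(⌊x * N⌋₊ : ℝ≥0) / N, ⟨N, ⌊x * N⌋₊, by exact_mod_cast hN0, rfl⟩, ?_⟩
  have h1 : ((⌊x * N⌋₊ : ℝ≥0) : ℝ) ≤ x * N := by
    exact_mod_cast Nat.floor_le (zero_le : 0 ≤ x * N)
  have h2 : (x : ℝ) * N < (⌊x * N⌋₊ : ℝ≥0) + 1 := by
    exact_mod_cast Nat.lt_floor_add_one (x * N)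
  rw [Metric.mem_ball, NNReal.dist_eq, NNReal.coe_div, NNReal.coe_natCast, NNReal.coe_natCast,
    abs_sub_lt_iff]
  have h3 : ε⁻¹ * ε = 1 := inv_mul_cancel₀ hε.ne'
  have h4 : 1 < N * ε := by nlinarith
  push_cast at h1 h2
  constructor
  · have : (⌊x * N⌋₊ : ℝ) / N ≤ x := (div_le_iff₀ hN0).2 h1
    linarith
  · rw [sub_lt_iff_lt_add', ← sub_lt_iff_lt_add, lt_div_iff₀ hN0]
    nlinarith

/-- Two rationals have a common denominator, so the pairs `(a / N, b / N)` are dense. -/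
theorem NNReal.eq_of_grid {A : Type*} [TopologicalSpace A] [T2Space A]
    {f g : ℝ≥0 → ℝ≥0 → A} (hf : Continuous (uncurry f)) (hg : Continuous (uncurry g))
    (h : ∀ N : ℕ, 0 < N → ∀ a b : ℕ, f (a / N) (b / N) = g (a / N) (b / N)) (s t : ℝ≥0) :
    f s t = g s t := by
  have key : uncurry f = uncurry g := by
    refine Continuous.ext_on (NNReal.dense_grid.prod NNReal.dense_grid) hf hg ?_
    rintro ⟨x, y⟩ ⟨⟨N, a, hN, rfl⟩, M, b, hM, rfl⟩
    have hN' : (N : ℝ≥0) ≠ 0 := by exact_mod_cast hN.ne'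
    have hM' : (M : ℝ≥0) ≠ 0 := by exact_mod_cast hM.ne'
    have := h (N * M) (Nat.mul_pos hN hM) (a * M) (b * N)
    have e1 : ((a * M : ℕ) : ℝ≥0) / (N * M : ℕ) = a / N := by
      push_cast
      exact mul_div_mul_right _ _ hM'
    have e2 : ((b * N : ℕ) : ℝ≥0) / (N * M : ℕ) = b / M := by
      push_cast
      rw [mul_comm (N : ℝ≥0)]
      exact mul_div_mul_right _ _ hN'
    rwa [e1, e2] at this
  exact congrFun key (s, t)

/-- The extension of an additive map on `ℝ≥0` to an additive map on `ℝ`. -/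
def realExtension {G : Type*} [AddCommGroup G] (B : ℝ≥0 →+ G) : ℝ →+ G where
  toFun t := B t.toNNReal - B (-t).toNNReal
  map_zero' := by simp
  map_add' s t := by
    have : (s + t).toNNReal + (-s).toNNReal + (-t).toNNReal
        = (-(s + t)).toNNReal + s.toNNReal + t.toNNReal := by
      apply NNReal.eq
      push_cast
      simp only [Real.coe_toNNReal']
      have h : ∀ r : ℝ, max r 0 = max (-r) 0 + r := fun r => by
        rcases le_total r 0 with h | h
        · rw [max_eq_right h, max_eq_left (by linarith)]; ring
        · rw [max_eq_left h, max_eq_right (by linarith)]; ring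
      linarith [h s, h t, h (s + t)]
    have := congrArg B this
    simp only [map_add] at this
    rw [sub_eq_iff_eq_add]
    have h2 := eq_sub_of_add_eq (eq_sub_of_add_eq this)
    rw [h2]
    abel

theorem realExtension_coe {G : Type*} [AddCommGroup G] (B : ℝ≥0 →+ G) (t : ℝ≥0) :
    realExtension B t = B t := by
  simp [realExtension, Real.toNNReal_of_nonpos]

variable {A : Type*} [AddCommGroup A] [TopologicalSpace A] [IsTopologicalAddGroup A]

variable {K : Type*} [TopologicalSpace K]

theorem continuous_fwdDiff_iter {F : ℝ≥0 → K → A} (hF : Continuous (uncurry F)) (k : ℕ) :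
    Continuous fun z : ℝ≥0 × ℝ≥0 × K => Δ_[z.1] ^[k] F z.2.1 z.2.2 := by
  simp only [fwdDiff_iter_eq_sum_shift, Finset.sum_apply, Pi.smul_apply]
  refine continuous_finsetSum _ fun j _ => ?_
  refine Continuous.zsmul ?_ _
  exact hF.comp (f := fun z : ℝ≥0 × ℝ≥0 × K => (z.2.1 + j • z.1, z.2.2)) (by fun_prop)

/-- A family of continuous maps `ℝ≥0 → A` annihilated by all `(n + 1)`-st differences is joined to
its value at `0` by a continuous family of one-parameter groups. -/
theorem exists_oneParameter_of_fwdDiff_eq_zero [T2Space A] (n : ℕ) (S : AddSubgroup (K → A))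
    (F : ℝ≥0 → K → A) (hF : Continuous (uncurry F)) (hS : ∀ t, F t ∈ S)
    (hP : ∀ h, Δ_[h] ^[n + 1] F = 0) :
    ∃ G : ℝ →+ (K → A), Continuous (fun z : ℝ × K => G z.1 z.2) ∧ (∀ t, G t ∈ S) ∧
      G 1 = F 1 - F 0 := by
  induction n generalizing F with
  | zero =>
    refine ⟨0, continuous_const, fun t => S.zero_mem, ?_⟩
    have := congrFun (hP 1) 0
    simp only [zero_add, iterate_one, fwdDiff, Pi.zero_apply] at this
    exact this.symm
  | succ k ih =>
    set U : ℝ≥0 → K → A := Δ_[1] ^[k] F with hU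
    have hUc : Continuous (uncurry U) :=
      (continuous_fwdDiff_iter hF k).comp (f := fun z : ℝ≥0 × K => (1, z.1, z.2)) (by fun_prop)
    have grid : ∀ N : ℕ, 0 < N → ∀ a : ℕ,
        U (a / N) - U 0 = (a * N ^ k) • Δ_[(N : ℝ≥0)⁻¹] ^[k + 1] F 0 := by
      intro N hN a
      have hN' : (N : ℝ≥0) ≠ 0 := by exact_mod_cast hN.ne'
      have := congrFun (fwdDiff_nsmul_iter_nsmul k (hP (N : ℝ≥0)⁻¹) a N) 0
      simpa only [nsmul_eq_mul, mul_inv_cancel₀ hN', ← div_eq_mul_inv, fwdDiff, zero_add,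
        Pi.smul_apply] using this
    have hadd : ∀ s t : ℝ≥0, U (s + t) - U 0 = (U s - U 0) + (U t - U 0) := by
      intro s t
      funext X
      have h1 : Continuous fun z : ℝ≥0 × ℝ≥0 => U (z.1 + z.2) X :=
        hUc.comp (f := fun z : ℝ≥0 × ℝ≥0 => (z.1 + z.2, X)) (by fun_prop)
      have h2 : Continuous fun z : ℝ≥0 × ℝ≥0 => U z.1 X :=
        hUc.comp (f := fun z : ℝ≥0 × ℝ≥0 => (z.1, X)) (by fun_prop)
      have h3 : Continuous fun z : ℝ≥0 × ℝ≥0 => U z.2 X :=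
        hUc.comp (f := fun z : ℝ≥0 × ℝ≥0 => (z.2, X)) (by fun_prop)
      refine NNReal.eq_of_grid (f := fun s t => (U (s + t) - U 0) X)
        (g := fun s t => ((U s - U 0) + (U t - U 0)) X) ?_ ?_ ?_ s t
      · exact h1.sub continuous_const
      · exact (h2.sub continuous_const).add (h3.sub continuous_const)
      · intro N hN a b
        have := grid N hN (a + b)
        rw [← add_div, ← Nat.cast_add, this, grid N hN a, grid N hN b, add_mul, add_nsmul]
    -- The polarized leading term: unit step in `k` slots and `t` in the last one.
    let B₀ : ℝ≥0 →+ (K → A) :=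
      { toFun := fun t => U t - U 0, map_zero' := sub_self _, map_add' := hadd }
    let B := realExtension B₀
    have hBc : Continuous fun z : ℝ × K => B z.1 z.2 := by
      have h1 : Continuous fun z : ℝ × K => U z.1.toNNReal z.2 :=
        hUc.comp (f := fun z : ℝ × K => (z.1.toNNReal, z.2)) (by fun_prop)
      have h2 : Continuous fun z : ℝ × K => U (-z.1).toNNReal z.2 :=
        hUc.comp (f := fun z : ℝ × K => ((-z.1).toNNReal, z.2)) (by fun_prop)
      have h3 : Continuous fun z : ℝ × K => U 0 z.2 :=
        hUc.comp (f := fun z : ℝ × K => (0, z.2)) (by fun_prop)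
      exact (h1.sub h3).sub (h2.sub h3)
    have hUS : ∀ t, U t ∈ S := fun t => fwdDiff_iter_mem hS 1 k t
    have hBS : ∀ t, B t ∈ S := fun t =>
      S.sub_mem (S.sub_mem (hUS _) (hUS _)) (S.sub_mem (hUS _) (hUS _))
    have htop : ∀ h y : ℝ≥0, Δ_[h] ^[k + 1] F y = B ((h : ℝ) ^ (k + 1)) := by
      intro h y
      funext X
      refine NNReal.eq_of_grid (f := fun h y => Δ_[h] ^[k + 1] F y X)
        (g := fun h y => B ((h : ℝ) ^ (k + 1)) X) ?_ ?_ ?_ h y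
      · exact (continuous_fwdDiff_iter hF (k + 1)).comp
          (f := fun z : ℝ≥0 × ℝ≥0 => (z.1, z.2, X)) (by fun_prop)
      · exact hBc.comp (f := fun z : ℝ≥0 × ℝ≥0 => ((z.1 : ℝ) ^ (k + 1), X)) (by fun_prop)
      · intro N hN a c
        have hN' : (N : ℝ≥0) ≠ 0 := by exact_mod_cast hN.ne'
        -- This mesh is fine enough that both sides are integer multiples of one element, `Δ_[e] ^[k
        -- + 1] F 0`: `a / N` is a multiple of `e`, and so is `(a / N) ^ (k + 1)`.
        set e : ℝ≥0 := ((N ^ (k + 1) : ℕ) : ℝ≥0)⁻¹ with he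
        have hstep : ∀ a : ℕ, (a : ℝ≥0) / N = (a * N ^ k) • e := by
          intro a
          rw [he, nsmul_eq_mul]
          push_cast
          field_simp
          ring
        have hpow : (((a : ℝ≥0) / N : ℝ≥0) : ℝ) ^ (k + 1)
            = (((a ^ (k + 1) : ℕ) / (N ^ (k + 1) : ℕ) : ℝ≥0) : ℝ) := by
          push_cast
          rw [div_pow]
        have hper : Δ_[(c * N ^ k) • e] (Δ_[e] ^[k + 1] F) 0 = 0 := by
          have h0 : Δ_[e] (Δ_[e] ^[k + 1] F) = 0 := by rw [← iterate_succ_apply' (fwdDiff e), hP]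
          rw [fwdDiff_nsmul_eq, h0, smul_zero]
          · rfl
          · rw [h0, fwdDiff_zero_fun]
        rw [fwdDiff, zero_add, sub_eq_zero] at hper
        rw [hstep a, hstep c, fwdDiff_iter_nsmul_eq (k + 1) (hP e), Pi.smul_apply, hper,
          ← hstep a, hpow]
        change _ = realExtension B₀ _ X
        rw [realExtension_coe]
        change _ = (U _ - U 0) X
        rw [grid (N ^ (k + 1)) (pow_pos hN _)]
        have hc : (a * N ^ k) ^ (k + 1) = a ^ (k + 1) * (N ^ (k + 1)) ^ k := by ring
        rw [hc]
    -- Remove the leading term; the factorial is divided out in `ℝ`, not in `A`.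
    let F' : ℝ≥0 → K → A := fun t => F t - B ((t : ℝ) ^ (k + 1) / (k + 1).factorial)
    have hfac : ((k + 1).factorial : ℝ) ≠ 0 := by exact_mod_cast Nat.factorial_ne_zero _
    have hF'c : Continuous (uncurry F') :=
      hF.sub (hBc.comp (f := fun z : ℝ≥0 × K =>
        ((z.1 : ℝ) ^ (k + 1) / (k + 1).factorial, z.2)) (by fun_prop))
    have hF'P : ∀ h, Δ_[h] ^[k + 1] F' = 0 := by
      intro h
      funext y
      have h1 := htop h y
      rw [fwdDiff_iter_eq_sum_shift] at h1 ⊢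
      simp only [F', smul_sub, Finset.sum_sub_distrib]
      rw [h1, Pi.zero_apply, sub_eq_zero]
      have h2 := fwdDiff_iter_pow_real (k + 1) y h
      rw [← mul_div_cancel_left₀ ((h : ℝ) ^ (k + 1)) hfac, ← h2, Finset.sum_div, map_sum]
      refine Finset.sum_congr rfl fun j _ => ?_
      rw [← map_zsmul, smul_div_assoc]
      simp only [nsmul_eq_mul, NNReal.coe_add, NNReal.coe_mul, NNReal.coe_natCast]
    obtain ⟨G, hGc, hGS, hG1⟩ := ih F' hF'c (fun t => S.sub_mem (hS t) (hBS _)) hF'P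
    refine ⟨G + B.comp (AddMonoidHom.mulRight ((k + 1).factorial : ℝ)⁻¹), ?_, ?_, ?_⟩
    · exact hGc.add (hBc.comp (f := fun z : ℝ × K =>
        (z.1 * ((k + 1).factorial : ℝ)⁻¹, z.2)) (by fun_prop))
    · exact fun t => S.add_mem (hGS t) (hBS _)
    · rw [AddMonoidHom.add_apply, hG1]
      simp [F', div_eq_mul_inv]
      abel

end ContinuousPolynomial

/-! ### From simplices to polytopes. -/

section HalfspaceInter

open Set Module

variable {V A : Type*} [NormedAddCommGroup V] [NormedSpace ℝ V] [AddCommGroup A]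

/-- The intersection of the half-spaces where the given affine functions are nonnegative. -/
def halfspaceInter (s : List (V →ᵃ[ℝ] ℝ)) : Set V := {x | ∀ g ∈ s, 0 ≤ g x}

theorem mem_halfspaceInter {s : List (V →ᵃ[ℝ] ℝ)} {x : V} :
    x ∈ halfspaceInter s ↔ ∀ g ∈ s, 0 ≤ g x := Iff.rfl

theorem halfspaceInter_cons (g : V →ᵃ[ℝ] ℝ) (s : List (V →ᵃ[ℝ] ℝ)) :
    halfspaceInter (g :: s) = halfspaceInter s ∩ {x | 0 ≤ g x} := by
  ext x
  simp only [mem_halfspaceInter, List.forall_mem_cons, mem_inter_iff, mem_ofPred_eq]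
  tauto

theorem convex_halfspaceInter (s : List (V →ᵃ[ℝ] ℝ)) : Convex ℝ (halfspaceInter s) := by
  induction s with
  | nil => simpa [halfspaceInter] using convex_univ
  | cons g s ih =>
    rw [halfspaceInter_cons]
    exact ih.inter ((convex_Ici (0 : ℝ)).affine_preimage g)

theorem isClosed_halfspaceInter [FiniteDimensional ℝ V] (s : List (V →ᵃ[ℝ] ℝ)) :
    IsClosed (halfspaceInter s) := by
  induction s with
  | nil => simp [halfspaceInter]
  | cons g s ih =>
    rw [halfspaceInter_cons]
    exact ih.inter (isClosed_le continuous_const g.continuous_of_finiteDimensional)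

theorem halfspaceInter_append_subset_right (D s : List (V →ᵃ[ℝ] ℝ)) :
    halfspaceInter (D ++ s) ⊆ halfspaceInter s :=
  fun _ hx g hg => hx g (List.mem_append_right D hg)

/-- A set valuation vanishing on all cells of a central hyperplane arrangement at `p` vanishes on
the polytope which is subdivided. -/
theorem IsSetValuation.eq_zero_of_cells [FiniteDimensional ℝ V] {θ : Set V → A}
    (hθ : IsSetValuation θ) {p : V} {s : List (V →ᵃ[ℝ] ℝ)} (hs : IsCompact (halfspaceInter s))
    (L : List (V →ᵃ[ℝ] ℝ)) (hL : ∀ h ∈ L, h p = 0)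
    (H : ∀ D : List (V →ᵃ[ℝ] ℝ), (∀ h ∈ D, h p = 0) →
      (∀ h ∈ L, (∀ x ∈ halfspaceInter (D ++ s), h x ≤ 0) ∨
        (∀ x ∈ halfspaceInter (D ++ s), 0 ≤ h x)) → θ (halfspaceInter (D ++ s)) = 0) :
    ∀ D : List (V →ᵃ[ℝ] ℝ), (∀ h ∈ D, h p = 0) → θ (halfspaceInter (D ++ s)) = 0 := by
  induction L with
  | nil => exact fun D hD => H D hD (by simp)
  | cons h L ih =>
    refine ih (fun h' hh' => hL h' (List.mem_cons_of_mem _ hh')) fun D hD hsign => ?_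
    have hp : h p = 0 := hL h List.mem_cons_self
    have hp' : (-h) p = 0 := by simp [hp]
    have hcomp : IsCompact (halfspaceInter (D ++ s)) :=
      hs.of_isClosed_subset (isClosed_halfspaceInter _) (halfspaceInter_append_subset_right D s)
    have e1 : halfspaceInter (D ++ s) ∩ {x | h x ≤ 0} = halfspaceInter ((-h :: D) ++ s) := by
      rw [List.cons_append, halfspaceInter_cons]
      simp
    have e2 : halfspaceInter (D ++ s) ∩ {x | 0 ≤ h x} = halfspaceInter ((h :: D) ++ s) := by
      rw [List.cons_append, halfspaceInter_cons]
    -- The common face is itself a cell, on which `h` has a constant sign as well.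
    have e3 : halfspaceInter (D ++ s) ∩ {x | h x = 0} = halfspaceInter ((-h :: h :: D) ++ s) := by
      rw [List.cons_append, List.cons_append, halfspaceInter_cons, halfspaceInter_cons, inter_assoc]
      congr 1
      ext x
      simp [le_antisymm_iff, and_comm]
    have sub : ∀ D', halfspaceInter (D' ++ s) ⊆ halfspaceInter (D ++ s) →
        ∀ h ∈ L, (∀ x ∈ halfspaceInter (D' ++ s), h x ≤ 0) ∨
          (∀ x ∈ halfspaceInter (D' ++ s), 0 ≤ h x) := fun D' hD' h' hh' =>
      (hsign h' hh').imp (fun H x hx => H x (hD' hx)) (fun H x hx => H x (hD' hx))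
    rw [hθ.cut h (convex_halfspaceInter _) hcomp, e1, e2, e3, H, H, H]
    · simp
    · simpa [hp] using hD
    · refine List.forall_mem_cons.2 ⟨Or.inr ?_, sub _ (e3 ▸ inter_subset_left)⟩
      rw [← e3]
      exact fun x hx => hx.2.ge
    · simpa [hp] using hD
    · refine List.forall_mem_cons.2 ⟨Or.inr ?_, sub _ (e2 ▸ inter_subset_left)⟩
      rw [← e2]
      exact fun x hx => hx.2
    · simpa [hp] using hD
    · refine List.forall_mem_cons.2 ⟨Or.inl ?_, sub _ (e1 ▸ inter_subset_left)⟩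
      rw [← e1]
      exact fun x hx => hx.2

/-- A compact cell on which `g` is the least of the constraints not vanishing at `p` is a cone. -/
theorem halfspaceInter_eq_convexJoin {p : V} {D s : List (V →ᵃ[ℝ] ℝ)}
    (hD : ∀ h ∈ D, h p = 0) (hs : ∀ g ∈ s, g p = 1)
    (hK : Bornology.IsBounded (halfspaceInter (D ++ s))) (hne : halfspaceInter (D ++ s) ≠ {p})
    {g : V →ᵃ[ℝ] ℝ} (hg : g ∈ s) (hmin : ∀ g' ∈ s, ∀ x ∈ halfspaceInter (D ++ s), g x ≤ g' x) :
    (halfspaceInter (D ++ s) ∩ {x | g x = 0}).Nonempty ∧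
      halfspaceInter (D ++ s) = convexJoin ℝ {p} (halfspaceInter (D ++ s) ∩ {x | g x = 0}) := by
  set K := halfspaceInter (D ++ s)
  have hline : ∀ (f : V →ᵃ[ℝ] ℝ) (x : V) (r : ℝ),
      f (AffineMap.lineMap p x r) = f p + r * (f x - f p) := fun f x r => by
    rw [AffineMap.apply_lineMap, AffineMap.lineMap_apply, vsub_eq_sub, smul_eq_mul, vadd_eq_add,
      add_comm]
  have hpK : p ∈ K := by
    intro f hf
    rcases List.mem_append.1 hf with h | h
    · exact (hD f h).ge
    · exact zero_le_one.trans (hs f h).ge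
  -- Along a ray from `p`, constraints in `D` just scale, while those in `s` start at `1` and stay
  -- above `g`. Hence `g` alone decides when the ray leaves `K`.
  have hray : ∀ x ∈ K, ∀ r : ℝ, 0 ≤ r → 0 ≤ 1 + r * (g x - 1) → AffineMap.lineMap p x r ∈ K := by
    intro x hx r hr h f hf
    rw [hline]
    rcases List.mem_append.1 hf with hfD | hfs
    · rw [hD f hfD, sub_zero, zero_add]
      exact mul_nonneg hr (hx f hf)
    · rw [hs f hfs]
      refine h.trans ?_
      have := hmin f hfs x hx
      gcongr
  -- Otherwise `g` never decreases along the ray, which then lies in the bounded set `K`.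
  have hlt : ∀ x ∈ K, x ≠ p → g x < 1 := by
    intro x hx hxp
    by_contra! hge
    obtain ⟨C, hC⟩ := hK.subset_closedBall p
    have hd : 0 < dist p x := dist_pos.2 hxp.symm
    have hC0 : 0 ≤ C := dist_nonneg.trans (hC hx)
    have hr : 0 ≤ (C + 1) / dist p x := by positivity
    have hmem := hC (hray x hx _ hr (by nlinarith [mul_nonneg hr (sub_nonneg.2 hge)]))
    rw [Metric.mem_closedBall, dist_lineMap_left, Real.norm_of_nonneg hr,
      div_mul_cancel₀ _ hd.ne'] at hmem
    linarith
  have hbase : ∀ x ∈ K, x ≠ p → AffineMap.lineMap p x (1 - g x)⁻¹ ∈ K ∩ {x | g x = 0} := by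
    intro x hx hxp
    have h1 : 0 < 1 - g x := sub_pos.2 (hlt x hx hxp)
    have h2 : 1 + (1 - g x)⁻¹ * (g x - 1) = 0 := by
      field_simp
      ring
    refine ⟨hray x hx _ (inv_nonneg.2 h1.le) h2.ge, ?_⟩
    change g _ = 0
    rw [hline, hs g hg, h2]
  obtain ⟨x₀, hx₀, hx₀p⟩ : ∃ x ∈ K, x ≠ p := by
    by_contra! h
    exact hne (Subset.antisymm (fun x hx => h x hx) (by simpa using hpK))
  have hnon := hbase x₀ hx₀ hx₀p
  refine ⟨⟨_, hnon⟩, Subset.antisymm (fun x hx => ?_) ?_⟩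
  · rcases eq_or_ne x p with rfl | hxp
    · exact subset_convexJoin_left ⟨_, hnon⟩ rfl
    · have h1 : 0 < 1 - g x := sub_pos.2 (hlt x hx hxp)
      have h0 : 0 ≤ g x := hx g (List.mem_append_right D hg)
      rw [mem_convexJoin]
      refine ⟨p, rfl, _, hbase x hx hxp, ?_⟩
      rw [segment_eq_image_lineMap]
      refine ⟨1 - g x, ⟨h1.le, by linarith⟩, ?_⟩
      rw [AffineMap.lineMap_lineMap_right, mul_inv_cancel₀ h1.ne', AffineMap.lineMap_apply_one]
  · exact convexJoin_subset (by simpa using hpK) inter_subset_left (convex_halfspaceInter _)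

/-- Taking the midpoint with a witness for one more constraint keeps the earlier ones positive. -/
theorem exists_pos_of_forall_exists_pos {P : Set V} (hP : Convex ℝ P) (hne : P.Nonempty)
    (l : List (V →ᵃ[ℝ] ℝ)) (hl : ∀ g ∈ l, ∀ x ∈ P, 0 ≤ g x) (hl' : ∀ g ∈ l, ∃ x ∈ P, 0 < g x) :
    ∃ p ∈ P, ∀ g ∈ l, 0 < g p := by
  induction l with
  | nil => exact ⟨_, hne.some_mem, by simp⟩
  | cons g l ih =>
    rw [List.forall_mem_cons] at hl hl'
    obtain ⟨p, hp, hpl⟩ := ih hl.2 hl'.2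
    obtain ⟨x, hx, hgx⟩ := hl'.1
    have hmid : ∀ f : V →ᵃ[ℝ] ℝ, f (midpoint ℝ p x) = (f p + f x) / 2 := fun f => by
      rw [f.map_midpoint, midpoint_eq_smul_add, smul_eq_mul, invOf_eq_inv]
      ring
    refine ⟨midpoint ℝ p x, hP.midpoint_mem hp hx, List.forall_mem_cons.2 ⟨?_, fun f hf => ?_⟩⟩
    · rw [hmid]
      linarith [hl.1 p hp]
    · rw [hmid]
      linarith [hpl f hf, hl.2 f hf x hx]

theorem exists_least_of_total {K : Set V} (l : List (V →ᵃ[ℝ] ℝ)) (hne : l ≠ [])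
    (hl : ∀ g ∈ l, ∀ g' ∈ l, (∀ x ∈ K, g x ≤ g' x) ∨ (∀ x ∈ K, g' x ≤ g x)) :
    ∃ g ∈ l, ∀ g' ∈ l, ∀ x ∈ K, g x ≤ g' x := by
  induction l with
  | nil => exact absurd rfl hne
  | cons f l ih =>
    rcases eq_or_ne l [] with rfl | hl0
    · exact ⟨f, List.mem_cons_self, by simp⟩
    obtain ⟨g, hg, hmin⟩ := ih hl0 fun g hg g' hg' =>
      hl g (List.mem_cons_of_mem _ hg) g' (List.mem_cons_of_mem _ hg')
    rcases hl g (List.mem_cons_of_mem _ hg) f List.mem_cons_self with h | h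
    · exact ⟨g, List.mem_cons_of_mem _ hg, List.forall_mem_cons.2 ⟨h, hmin⟩⟩
    · exact ⟨f, List.mem_cons_self, List.forall_mem_cons.2
        ⟨fun x _ => le_rfl, fun g' hg' x hx => (h x hx).trans (hmin g' hg' x hx)⟩⟩

/-- A parametrization of the zero set of an affine function by the kernel of its linear part. -/
theorem exists_hyperplane_parametrization [FiniteDimensional ℝ V] (g : V →ᵃ[ℝ] ℝ) {q : V}
    (hq : g q = 0) : ∃ L : LinearMap.ker g.linear →ᵃ[ℝ] V,
      Topology.IsClosedEmbedding L ∧ (∀ x, g (L x) = 0) ∧ {x | g x = 0} ⊆ range L := by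
  let L : LinearMap.ker g.linear →ᵃ[ℝ] V :=
    (LinearMap.ker g.linear).subtype.toAffineMap + AffineMap.const ℝ _ q
  have hL : ∀ x, L x = (x : V) + q := fun x => rfl
  refine ⟨L, ?_, fun x => ?_, fun x hx => ?_⟩
  · refine Isometry.isClosedEmbedding (Isometry.of_dist_eq fun x y => ?_)
    rw [hL, hL, dist_add_right, Subtype.dist_eq]
  · have := g.map_vadd q x.1
    rw [vadd_eq_add, vadd_eq_add, hq, add_zero] at this
    rw [hL, this]
    exact x.2
  · refine ⟨⟨x - q, ?_⟩, by rw [hL]; simp⟩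
    have := g.linearMap_vsub x q
    rw [vsub_eq_sub, vsub_eq_sub, hq, sub_zero] at this
    exact this.trans hx

theorem finrank_ker_linear [FiniteDimensional ℝ V] {g : V →ᵃ[ℝ] ℝ} (hg : g.linear ≠ 0) {d : ℕ}
    (hd : finrank ℝ V = d + 1) : finrank ℝ (LinearMap.ker g.linear) = d := by
  have h1 := g.linear.finrank_range_add_finrank_ker
  have h2 : LinearMap.range g.linear = ⊤ := LinearMap.range_eq_top.2 (LinearMap.surjective hg)
  rw [h2, finrank_top, finrank_self, hd] at h1
  omega

theorem preimage_halfspaceInter {V' : Type*} [NormedAddCommGroup V'] [NormedSpace ℝ V']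
    (L : V' →ᵃ[ℝ] V) (s : List (V →ᵃ[ℝ] ℝ)) :
    L ⁻¹' halfspaceInter s = halfspaceInter (s.map fun g => g.comp L) := by
  ext x
  simp [mem_halfspaceInter]

/-- A set valuation on a `d`-dimensional space which vanishes on all convex hulls of `d + 1` points
vanishes on all polytopes. -/
theorem IsSetValuation.eq_zero_of_simplices {A : Type v} [AddCommGroup A] (d : ℕ) :
    ∀ {V : Type u} [NormedAddCommGroup V] [NormedSpace ℝ V] [FiniteDimensional ℝ V],
      finrank ℝ V = d → ∀ {θ : Set V → A}, IsSetValuation θ →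
      (∀ w : Fin (d + 1) → V, θ (convexHull ℝ (range w)) = 0) →
      ∀ s : List (V →ᵃ[ℝ] ℝ), IsCompact (halfspaceInter s) → θ (halfspaceInter s) = 0 := by
  classical
  induction d with
  | zero =>
    intro V _ _ _ hd θ hθ h0 s hs
    rcases (halfspaceInter s).eq_empty_or_nonempty with he | ⟨x, hx⟩
    · rw [he, hθ.empty]
    · have : Subsingleton V := finrank_zero_iff.1 hd
      have h1 : halfspaceInter s = convexHull ℝ (range fun _ : Fin (0 + 1) => x) := by
        rw [range_const, convexHull_singleton]
        exact Subsingleton.eq_univ_of_nonempty ⟨x, hx⟩ |>.trans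
          (Subsingleton.eq_univ_of_nonempty (singleton_nonempty x)).symm
      rw [h1, h0]
  | succ d ih =>
    intro V _ _ _ hd θ hθ h0 s hs
    have : Nontrivial V := nontrivial_of_finrank_pos (R := ℝ) (by omega)
    have hpoint : ∀ p : V, θ {p} = 0 := fun p => by simpa using h0 fun _ => p
    rcases (halfspaceInter s).eq_empty_or_nonempty with he | ⟨x₀, hx₀⟩
    · rw [he, hθ.empty]
    set s' := s.filter fun g => g.linear ≠ 0 with hs'
    have hss' : halfspaceInter s = halfspaceInter s' := by
      refine Subset.antisymm (fun x hx g hg => hx g (List.mem_of_mem_filter hg)) fun x hx g hg => ?_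
      by_cases hlin : g.linear = 0
      · have := g.linearMap_vsub x x₀
        rw [hlin, LinearMap.zero_apply, vsub_eq_sub, eq_comm, sub_eq_zero] at this
        exact (hx₀ g hg).trans this.ge
      · exact hx g (List.mem_filter.2 ⟨hg, by simpa using hlin⟩)
    have hlin : ∀ g ∈ s', g.linear ≠ 0 := fun g hg => by simpa using (List.mem_filter.1 hg).2
    rw [hss'] at hs hx₀ ⊢
    -- Either the polytope lies in a hyperplane and the dimension drops, or it has a point `p` where
    -- all constraints are positive.
    by_cases hflat : ∃ g ∈ s', ∀ x ∈ halfspaceInter s', g x ≤ 0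
    · obtain ⟨g, hg, hgx⟩ := hflat
      have hsub : halfspaceInter s' ⊆ {x | g x = 0} := fun x hx => (hgx x hx).antisymm (hx g hg)
      obtain ⟨L, hLe, hgL, hLr⟩ := exists_hyperplane_parametrization g (hsub hx₀)
      have := ih (finrank_ker_linear (hlin g hg) hd) (hθ.image L hLe.continuous) (fun w => by
        rw [L.image_convexHull, ← range_comp]
        -- Repeating a vertex makes the lower-dimensional simplex a degenerate one with `d + 2`
        -- points.
        have h := h0 (Fin.cons (L (w 0)) (L ∘ w))
        rwa [Fin.range_cons, insert_eq_of_mem (show L (w 0) ∈ range (L ∘ w) from ⟨0, rfl⟩)] at h)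
        (s'.map fun f => f.comp L) (by
          rw [← preimage_halfspaceInter]
          exact hLe.isCompact_preimage hs)
      rwa [← preimage_halfspaceInter, image_preimage_eq_of_subset (hsub.trans hLr)] at this
    · push Not at hflat
      obtain ⟨p, hp, hpos⟩ := exists_pos_of_forall_exists_pos (convex_halfspaceInter s') ⟨x₀, hx₀⟩
        s' (fun g hg x hx => hx g hg) hflat
      -- Normalized to value `1` at `p`, any two constraints differ by a function vanishing at `p`.
      -- Cutting along these differences orders the constraints on each cell, so that one of them is
      -- least.
      set t := s'.map fun g => (g p)⁻¹ • g with ht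
      have hst : halfspaceInter s' = halfspaceInter t := by
        ext x
        simp only [mem_halfspaceInter, ht, List.forall_mem_map, AffineMap.coe_smul, Pi.smul_apply,
          smul_eq_mul]
        exact forall₂_congr fun g hg => (mul_nonneg_iff_of_pos_left (inv_pos.2 (hpos g hg))).symm
      have htp : ∀ g ∈ t, g p = 1 := by
        simp only [ht, List.forall_mem_map, AffineMap.coe_smul, Pi.smul_apply, smul_eq_mul]
        exact fun g hg => inv_mul_cancel₀ (hpos g hg).ne'
      rw [hst] at hs ⊢
      have htne : t ≠ [] := by
        rintro h
        rw [h] at hs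
        have : halfspaceInter ([] : List (V →ᵃ[ℝ] ℝ)) = univ := by simp [halfspaceInter]
        rw [this] at hs
        have := NormedSpace.noncompactSpace ℝ V
        exact noncompact_univ V hs
      refine hθ.eq_zero_of_cells hs ((t.product t).map fun z => z.1 - z.2) (p := p) ?_ ?_ []
        (by simp)
      · simp only [List.forall_mem_map, Prod.forall, List.pair_mem_product]
        rintro g g' ⟨hg, hg'⟩
        simp [htp g hg, htp g' hg']
      · intro D hD hsign
        have hcomp : IsCompact (halfspaceInter (D ++ t)) :=
          hs.of_isClosed_subset (isClosed_halfspaceInter _)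
            (halfspaceInter_append_subset_right D t)
        by_cases hKp : halfspaceInter (D ++ t) = {p}
        · rw [hKp, hpoint]
        obtain ⟨g, hg, hmin⟩ := exists_least_of_total (K := halfspaceInter (D ++ t)) t htne (by
          intro g hg g' hg'
          have := hsign (g - g') (List.mem_map.2 ⟨(g, g'), List.pair_mem_product.2 ⟨hg, hg'⟩, rfl⟩)
          simpa using this)
        obtain ⟨⟨q, hq⟩, hcone⟩ := halfspaceInter_eq_convexJoin hD htp hcomp.isBounded hKp hg hmin
        have hQ : halfspaceInter (D ++ t) ∩ {x | g x = 0} = halfspaceInter (-g :: (D ++ t)) := by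
          rw [halfspaceInter_cons]
          ext x
          refine and_congr_right fun hx => ?_
          have := hx g (List.mem_append_right D hg)
          simp only [mem_ofPred_eq, AffineMap.coe_neg, Pi.neg_apply, Left.nonneg_neg_iff]
          exact ⟨fun h => h.le, fun h => h.antisymm this⟩
        have hQc : IsCompact (halfspaceInter (-g :: (D ++ t))) := by
          rw [← hQ]
          exact hcomp.inter_right (isClosed_eq g.continuous_of_finiteDimensional continuous_const)
        obtain ⟨L, hLe, hgL, hLr⟩ := exists_hyperplane_parametrization g hq.2
        have hgp : g p = 1 := htp g hg
        have hglin : g.linear ≠ 0 := by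
          intro h
          have := g.linearMap_vsub p q
          rw [h, hgp, show g q = 0 from hq.2] at this
          norm_num at this
        -- Induction applies to `K ↦ θ (cone over K)` on the hyperplane: a cone over a simplex with
        -- `d + 1` points is one with `d + 2`.
        have := ih (finrank_ker_linear hglin hd)
          (hθ.cone L hLe.continuous (g := g) (p := p) (by rw [hgp]; exact one_ne_zero) hgL)
          (fun w => by
            rw [L.image_convexHull, ← range_comp, ← convexHull_insert (range_nonempty _),
              ← Fin.range_cons]
            exact h0 _)
          ((-g :: (D ++ t)).map fun f => f.comp L) (by
            rw [← preimage_halfspaceInter]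
            exact hLe.isCompact_preimage hQc)
        rw [hcone, hQ]
        rwa [← preimage_halfspaceInter, image_preimage_eq_of_subset] at this
        rw [← hQ]
        exact inter_subset_right.trans hLr

end HalfspaceInter

/-! ### Dilates under a translation-invariant valuation. -/

section Dilation

open Set Module Function fwdDiff
open scoped NNReal Pointwise

section InclusionExclusion

variable {V A : Type*} [NormedAddCommGroup V] [NormedSpace ℝ V] [FiniteDimensional ℝ V]
  [AddCommGroup A]

/-- Inclusion-exclusion for a compact convex set covered by half-spaces, up to the points lying on
all bounding hyperplanes. -/
theorem IsSetValuation.sum_powerset_eq_zero {θ : Set V → A} (hθ : IsSetValuation θ) {ι : Type*}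
    (g : ι → V →ᵃ[ℝ] ℝ) (J : Finset ι) (hJ : J.Nonempty) :
    ∀ K : Set V, Convex ℝ K → IsCompact K →
      (∀ x ∈ K, (∀ i ∈ J, g i x ≤ 0) → ∀ i ∈ J, g i x = 0) →
      ∑ I ∈ J.powerset, (-1 : ℤ) ^ I.card • θ (K ∩ {x | ∀ i ∈ I, 0 ≤ g i x}) = 0 := by
  classical
  have hcont : ∀ i, Continuous (g i) := fun i => (g i).continuous_of_finiteDimensional
  have hSconv : ∀ I : Finset ι, Convex ℝ {x | ∀ i ∈ I, 0 ≤ g i x} := fun I => by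
    have : {x | ∀ i ∈ I, 0 ≤ g i x} = ⋂ i ∈ I, g i ⁻¹' Ici 0 := by
      ext x
      simp
    rw [this]
    exact convex_iInter₂ fun i _ => (convex_Ici (0 : ℝ)).affine_preimage (g i)
  have hSclosed : ∀ I : Finset ι, IsClosed {x | ∀ i ∈ I, 0 ≤ g i x} := fun I => by
    have : {x | ∀ i ∈ I, 0 ≤ g i x} = ⋂ i ∈ I, g i ⁻¹' Ici 0 := by
      ext x
      simp
    rw [this]
    exact isClosed_biInter fun i _ => isClosed_Ici.preimage (hcont i)
  -- Pair each `I` with `insert j I`: by `cut`, removing the part `0 ≤ g j` leaves the part `g j ≤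
  -- 0` minus the part `g j = 0`.
  have step : ∀ (j : ι) (J : Finset ι), j ∉ J → ∀ K : Set V, Convex ℝ K → IsCompact K →
      ∑ I ∈ (insert j J).powerset, (-1 : ℤ) ^ I.card • θ (K ∩ {x | ∀ i ∈ I, 0 ≤ g i x})
        = ∑ I ∈ J.powerset, (-1 : ℤ) ^ I.card •
            θ ((K ∩ {x | g j x ≤ 0}) ∩ {x | ∀ i ∈ I, 0 ≤ g i x})
          - ∑ I ∈ J.powerset, (-1 : ℤ) ^ I.card •
            θ ((K ∩ {x | g j x = 0}) ∩ {x | ∀ i ∈ I, 0 ≤ g i x}) := by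
    intro j J hj K hK hKc
    rw [Finset.sum_powerset_insert hj, ← Finset.sum_add_distrib, ← Finset.sum_sub_distrib]
    refine Finset.sum_congr rfl fun I hI => ?_
    have hjI : j ∉ I := fun h => hj (Finset.mem_powerset.1 hI h)
    have hset : K ∩ {x | ∀ i ∈ insert j I, 0 ≤ g i x}
        = (K ∩ {x | ∀ i ∈ I, 0 ≤ g i x}) ∩ {x | 0 ≤ g j x} := by
      ext x
      simp only [Finset.forall_mem_insert, mem_inter_iff, mem_ofPred_eq]
      tauto
    rw [Finset.card_insert_of_notMem hjI, pow_succ, hset,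
      hθ.cut (g j) (hK.inter (hSconv I)) (hKc.inter_right (hSclosed I)),
      inter_right_comm K _ {x | g j x ≤ 0}, inter_right_comm K _ {x | g j x = 0}]
    module
  induction hJ using Finset.Nonempty.cons_induction with
  | singleton j =>
    intro K hK hKc h
    have := step j ∅ (Finset.notMem_empty j) K hK hKc
    rw [insert_empty_eq] at this
    rw [this, sub_eq_zero]
    have hset : K ∩ {x | g j x ≤ 0} = K ∩ {x | g j x = 0} := by
      ext x
      refine and_congr_right fun hx => ⟨fun hle => ?_, fun he => le_of_eq he⟩
      exact h x hx (by simpa using hle) j (by simp)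
    rw [hset]
  | cons j J hj hJ ih =>
    intro K hK hKc h
    rw [Finset.cons_eq_insert, step j J hj K hK hKc, ih, ih, sub_zero]
    · exact hK.inter ((convex_singleton (0 : ℝ)).affine_preimage (g j))
    · exact hKc.inter_right (isClosed_eq (hcont j) continuous_const)
    · intro x hx hle i hi
      exact h x hx.1 (Finset.forall_mem_cons hj _ |>.2 ⟨le_of_eq hx.2, hle⟩) i
        (Finset.mem_cons_of_mem hi)
    · exact hK.inter ((convex_Iic (0 : ℝ)).affine_preimage (g j))
    · exact hKc.inter_right (isClosed_le (hcont j) continuous_const)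
    · intro x hx hle i hi
      exact h x hx.1 (Finset.forall_mem_cons hj _ |>.2 ⟨hx.2, hle⟩) i
        (Finset.mem_cons_of_mem hi)

end InclusionExclusion

namespace ConvexBody

variable {V A : Type*} [NormedAddCommGroup V] [NormedSpace ℝ V] [AddCommGroup A]

open Classical in
/-- The extension of a function on convex bodies to all sets, by zero. -/
noncomputable def extend (φ : ConvexBody V → A) (S : Set V) : A :=
  if h : Convex ℝ S ∧ IsCompact S ∧ S.Nonempty then φ ⟨S, h.1, h.2.1, h.2.2⟩ else 0

theorem extend_coe (φ : ConvexBody V → A) (K : ConvexBody V) : extend φ (K : Set V) = φ K :=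
  dif_pos ⟨K.convex, K.isCompact, K.nonempty⟩

theorem IsValuation.isSetValuation {φ : ConvexBody V → A} (hφ : IsValuation φ) :
    IsSetValuation (extend φ) where
  empty := dif_neg (by simp)
  union B C hB hC hBc hCc hBk hCk h := by
    have hne := Convex.inter_nonempty_of_union hB hC hBk.isClosed hCk.isClosed h
    have := hφ ⟨B, hBc, hBk, hB⟩ ⟨C, hCc, hCk, hC⟩ ⟨B ∪ C, h, hBk.union hCk, hB.inl⟩
      ⟨B ∩ C, hBc.inter hCc, hBk.inter hCk, hne⟩ rfl rfl
    rwa [← extend_coe φ, ← extend_coe φ, ← extend_coe φ, ← extend_coe φ] at this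

/-- The convex hull of finitely many points. -/
def hull {ι : Type*} [Finite ι] [Nonempty ι] (w : ι → V) : ConvexBody V where
  carrier := convexHull ℝ (range w)
  convex' := convex_convexHull ℝ _
  isCompact' := (finite_range w).isCompact_convexHull ℝ
  nonempty' := (range_nonempty w).convexHull

theorem coe_hull {ι : Type*} [Finite ι] [Nonempty ι] (w : ι → V) :
    (hull w : Set V) = convexHull ℝ (range w) := rfl

theorem coe_translate (x : V) (K : ConvexBody V) :
    (translate x K : Set V) = (fun y => x + y) '' (K : Set V) := rfl

theorem smul_stdSimplex_eq {ι : Type*} [Fintype ι] [Nonempty ι] {r : ℝ} (hr : 0 ≤ r) :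
    r • stdSimplex ℝ ι = {a : ι → ℝ | (∀ i, 0 ≤ a i) ∧ ∑ i, a i = r} := by
  classical
  ext a
  constructor
  · rintro ⟨b, hb, rfl⟩
    refine ⟨fun i => mul_nonneg hr (hb.1 i), ?_⟩
    simp only [Pi.smul_apply, smul_eq_mul, ← Finset.mul_sum, hb.2, mul_one]
  · rintro ⟨ha, hsum⟩
    rcases hr.eq_or_lt with rfl | hr
    · have : a = 0 := funext fun i =>
        (Finset.sum_eq_zero_iff_of_nonneg fun i _ => ha i).1 hsum i (Finset.mem_univ i)
      rw [this, zero_smul_set ⟨_, single_mem_stdSimplex ℝ (Classical.arbitrary ι)⟩]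
      rfl
    · refine ⟨r⁻¹ • a, ⟨fun i => mul_nonneg (inv_nonneg.2 hr.le) (ha i), ?_⟩, ?_⟩
      · simp only [Pi.smul_apply, smul_eq_mul, ← Finset.mul_sum, hsum, inv_mul_cancel₀ hr.ne']
      · simp only [smul_smul, mul_inv_cancel₀ hr.ne', one_smul]

theorem coe_hull_eq_image {ι : Type*} [Fintype ι] [Nonempty ι] (w : ι → V) :
    (hull w : Set V) = Fintype.linearCombination ℝ w '' stdSimplex ℝ ι := by
  classical
  rw [coe_hull, ← convexHull_basis_eq_stdSimplex, LinearMap.image_convexHull, ← range_comp]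
  congr 2
  funext i
  simp [Fintype.linearCombination_apply, ite_smul]

/-- The part of a dilated simplex where some barycentric coordinates are at least `h` maps onto a
translate of a smaller dilate. -/
theorem image_slice_eq_translate {ι : Type*} [Fintype ι] [Nonempty ι] (w : ι → V) (h r : ℝ≥0)
    (I : Finset ι) :
    Fintype.linearCombination ℝ w '' {a : ι → ℝ | ((∀ i, 0 ≤ a i) ∧ ∑ i, a i = r + I.card * h) ∧
        ∀ i ∈ I, (h : ℝ) ≤ a i}
      = (translate (∑ i ∈ I, (h : ℝ) • w i) (r • hull w) : ConvexBody V) := by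
  classical
  set L := Fintype.linearCombination ℝ w with hL
  let c : ι → ℝ := fun i => if i ∈ I then (h : ℝ) else 0
  have hcL : L c = ∑ i ∈ I, (h : ℝ) • w i := by
    simp [hL, Fintype.linearCombination_apply, c, ite_smul, Finset.sum_ite_mem]
  have hcsum : ∑ i, c i = I.card * h := by simp [c, Finset.sum_ite_mem]
  have hc0 : ∀ i, 0 ≤ c i := fun i => by
    by_cases hi : i ∈ I <;> simp [c, hi]
  have hset : {a : ι → ℝ | ((∀ i, 0 ≤ a i) ∧ ∑ i, a i = r + I.card * h) ∧ ∀ i ∈ I, (h : ℝ) ≤ a i}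
      = (fun b => c + b) '' ((r : ℝ) • stdSimplex ℝ ι) := by
    rw [smul_stdSimplex_eq r.coe_nonneg]
    ext a
    constructor
    · rintro ⟨⟨ha, hsum⟩, hI⟩
      refine ⟨a - c, ⟨fun i => ?_, ?_⟩, by simp⟩
      · by_cases hi : i ∈ I
        · simpa [c, hi] using hI i hi
        · simpa [c, hi] using ha i
      · simp only [Pi.sub_apply, Finset.sum_sub_distrib, hsum, hcsum]
        ring
    · rintro ⟨b, ⟨hb, hsum⟩, rfl⟩
      refine ⟨⟨fun i => add_nonneg (hc0 i) (hb i), ?_⟩, fun i hi => ?_⟩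
      · simp only [Pi.add_apply, Finset.sum_add_distrib, hsum, hcsum]
        ring
      · simpa [c, hi] using hb i
  rw [hset, coe_translate, coe_smul', coe_hull_eq_image, image_image, ← hcL]
  simp only [map_add]
  change _ = _ '' ((r : ℝ) • (L '' stdSimplex ℝ ι))
  rw [← image_smul_set, image_image]

/-- Inclusion-exclusion for the simplex of total mass `y + n * h` and the slices `h ≤ a i`. The
slice over `I` is a translate of the dilate by `y + (n - I.card) * h`, so grouping by cardinality
produces the binomial sum of the `n`-th difference. The vertices `w` may be affinely dependent,
because the computation is done in the standard simplex. -/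
theorem fwdDiff_hull_eq_zero {φ : ConvexBody V → A} (hφ : IsValuation φ)
    (hinv : IsTranslationInvariant φ) {ι : Type*} [Fintype ι] [Nonempty ι] (w : ι → V)
    (h y : ℝ≥0) : Δ_[h] ^[Fintype.card ι] (fun t : ℝ≥0 => φ (t • hull w)) y = 0 := by
  classical
  set n := Fintype.card ι with hn
  set L := Fintype.linearCombination ℝ w with hL
  have hLc : Continuous L := L.continuous_of_finiteDimensional
  have hθ := hφ.isSetValuation.image L.toAffineMap hLc
  let g : ι → (ι → ℝ) →ᵃ[ℝ] ℝ := fun i =>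
    (LinearMap.proj i : (ι → ℝ) →ₗ[ℝ] ℝ).toAffineMap - AffineMap.const ℝ _ (h : ℝ)
  have hg : ∀ i a, g i a = a i - h := fun i a => rfl
  let K : Set (ι → ℝ) := {a | (∀ i, 0 ≤ a i) ∧ ∑ i, a i = y + n * h}
  have hKeq : K = ((y : ℝ) + n * h) • stdSimplex ℝ ι :=
    (smul_stdSimplex_eq (by positivity)).symm
  have key := hθ.sum_powerset_eq_zero g Finset.univ Finset.univ_nonempty K
    (hKeq ▸ (convex_stdSimplex ℝ ι).smul _) (hKeq ▸ (isCompact_stdSimplex ℝ ι).smul _) (by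
      -- If all `n` coordinates are at most `h` while their sum is `y + n * h`, they all equal `h`.
      rintro a ⟨-, hsum⟩ hle
      simp only [hg, Finset.mem_univ, true_imp_iff, sub_nonpos] at hle ⊢
      have hs : ∑ i, ((h : ℝ) - a i) = 0 := by
        refine le_antisymm ?_ (Finset.sum_nonneg fun i _ => sub_nonneg.2 (hle i))
        rw [Finset.sum_sub_distrib, hsum]
        simp [hn]
      intro i
      have := (Finset.sum_eq_zero_iff_of_nonneg fun i _ => sub_nonneg.2 (hle i)).1 hs i
        (Finset.mem_univ i)
      linarith)
  have hterm : ∀ I ∈ (Finset.univ : Finset ι).powerset,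
      (-1 : ℤ) ^ I.card • extend φ (L.toAffineMap '' (K ∩ {x | ∀ i ∈ I, 0 ≤ g i x}))
        = (fun k : ℕ => (-1 : ℤ) ^ k • φ ((y + (n - k) • h) • hull w)) I.card := by
    intro I _
    have hcard : I.card ≤ n := Finset.card_le_univ I
    have hset : K ∩ {x | ∀ i ∈ I, 0 ≤ g i x} = {a : ι → ℝ | ((∀ i, 0 ≤ a i) ∧
        ∑ i, a i = (y + (n - I.card) • h : ℝ≥0) + I.card * h) ∧ ∀ i ∈ I, (h : ℝ) ≤ a i} := by
      have : ((y + (n - I.card) • h : ℝ≥0) : ℝ) + I.card * h = y + n * h := by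
        rw [nsmul_eq_mul, NNReal.coe_add, NNReal.coe_mul, NNReal.coe_natCast, Nat.cast_sub hcard]
        ring
      rw [this]
      ext a
      simp [K, hg]
    have := image_slice_eq_translate w h (y + (n - I.card) • h) I
    rw [← hset, ← hL] at this
    simp only
    rw [LinearMap.coe_toAffineMap, this, extend_coe, hinv]
  rw [Finset.sum_congr rfl hterm, Finset.sum_powerset_apply_card (fun k : ℕ =>
    (-1 : ℤ) ^ k • φ ((y + (n - k) • h) • hull w)), Finset.card_univ, ← hn] at key
  rw [fwdDiff_iter_eq_sum_shift, ← key, ← Finset.sum_range_reflect]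
  refine Finset.sum_congr rfl fun k hk => ?_
  have hk' : k ≤ n := Nat.lt_succ_iff.1 (Finset.mem_range.1 hk)
  rw [show n + 1 - 1 - k = n - k by omega, show n - (n - k) = k by omega, Nat.choose_symm hk',
    mul_comm, mul_smul, natCast_zsmul]

/-- The group of translation-invariant valuations. -/
def invariantValuations (V A : Type*) [NormedAddCommGroup V] [NormedSpace ℝ V] [AddCommGroup A] :
    AddSubgroup (ConvexBody V → A) where
  carrier := {φ | IsValuation φ ∧ IsTranslationInvariant φ}
  add_mem' := by
    rintro φ ψ ⟨h1, h2⟩ ⟨h3, h4⟩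
    refine ⟨fun B C U I hU hI => ?_, fun x K => ?_⟩
    · simp only [Pi.add_apply, h1 B C U I hU hI, h3 B C U I hU hI]
      abel
    · simp only [Pi.add_apply, h2 x K, h4 x K]
  zero_mem' := ⟨fun B C U I _ _ => by simp, fun x K => rfl⟩
  neg_mem' := by
    rintro φ ⟨h1, h2⟩
    refine ⟨fun B C U I hU hI => ?_, fun x K => ?_⟩
    · simp only [Pi.neg_apply, h1 B C U I hU hI]
      abel
    · simp only [Pi.neg_apply, h2 x K]

theorem dilate_mem_invariantValuations {φ : ConvexBody V → A} (hφ : IsValuation φ)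
    (hinv : IsTranslationInvariant φ) (t : ℝ≥0) :
    (fun X => φ (t • X)) ∈ invariantValuations V A := by
  refine ⟨fun B C U I hU hI => ?_, fun x K => ?_⟩
  -- Dilation by `0` need not commute with intersections, but it sends every body to the same point.
  · rcases eq_or_ne t 0 with rfl | ht
    · simp
    · refine hφ _ _ _ _ ?_ ?_
      · rw [coe_smul', coe_smul', coe_smul', hU, smul_set_union]
      · rw [coe_smul', coe_smul', coe_smul', hI, smul_set_inter₀ ht]
  · have : t • translate x K = translate (t • x) (t • K) := by
      apply ConvexBody.ext
      rw [coe_translate, coe_smul', coe_smul', coe_translate]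
      simp only [← image_smul, image_image, smul_add]
    simp only [this, hinv _ _]

/-! ### Continuity of dilation and approximation by polytopes. -/

theorem exists_mem_dist_le (X Y : ConvexBody V) {x : V} (hx : x ∈ X) :
    ∃ y ∈ Y, dist x y ≤ dist X Y := by
  obtain ⟨y, hy, hxy⟩ := Y.isCompact.exists_infDist_eq_dist Y.nonempty x
  exact ⟨y, hy, hxy ▸ Metric.infDist_le_hausdorffDist_of_mem hx hausdorffEDist_ne_top⟩

theorem dist_smul_smul_le (t : ℝ≥0) (X Y : ConvexBody V) : dist (t • X) (t • Y) ≤ t * dist X Y := by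
  have key : ∀ X Y : ConvexBody V, ∀ x ∈ (t • X : ConvexBody V), ∃ y ∈ (t • Y : ConvexBody V),
      dist x y ≤ t * dist X Y := by
    rintro X Y _ ⟨x, hx, rfl⟩
    obtain ⟨y, hy, hxy⟩ := exists_mem_dist_le X Y hx
    refine ⟨t • y, smul_mem_smul_set hy, ?_⟩
    change dist ((t : ℝ) • x) ((t : ℝ) • y) ≤ _
    rw [dist_smul₀, Real.norm_of_nonneg t.coe_nonneg]
    gcongr
  refine Metric.hausdorffDist_le_of_mem_dist (by positivity) (key X Y) ?_
  rw [dist_comm X Y]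
  exact key Y X

theorem dist_smul_le {X : ConvexBody V} {C : ℝ} (hC : ∀ x ∈ X, ‖x‖ ≤ C) (s t : ℝ≥0) :
    dist (s • X) (t • X) ≤ dist s t * C := by
  obtain ⟨x₀, hx₀⟩ := X.nonempty
  have hC0 : 0 ≤ C := (norm_nonneg _).trans (hC x₀ hx₀)
  have key : ∀ s t : ℝ≥0, ∀ x ∈ (s • X : ConvexBody V), ∃ y ∈ (t • X : ConvexBody V),
      dist x y ≤ dist s t * C := by
    rintro s t _ ⟨x, hx, rfl⟩
    refine ⟨t • x, smul_mem_smul_set hx, ?_⟩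
    simp only [NNReal.smul_def]
    rw [dist_eq_norm, ← sub_smul, norm_smul, NNReal.dist_eq, Real.norm_eq_abs]
    gcongr
    exact hC x hx
  refine Metric.hausdorffDist_le_of_mem_dist (by positivity) (key s t) ?_
  rw [dist_comm s t]
  exact key t s

theorem continuous_smul_nnreal : Continuous fun z : ℝ≥0 × ConvexBody V => z.1 • z.2 := by
  rw [continuous_iff_continuousAt]
  rintro ⟨t, X⟩
  obtain ⟨C, hC⟩ := X.isBounded.exists_norm_le
  rw [ContinuousAt, tendsto_iff_dist_tendsto_zero]
  have hlim : Filter.Tendsto (fun z : ℝ≥0 × ConvexBody V => (z.1 : ℝ) * dist z.2 X + dist z.1 t * C)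
      (nhds (t, X)) (nhds 0) := by
    have : Continuous fun z : ℝ≥0 × ConvexBody V => (z.1 : ℝ) * dist z.2 X + dist z.1 t * C := by
      fun_prop
    simpa using this.tendsto (t, X)
  refine squeeze_zero (fun _ => dist_nonneg) (fun z => ?_) hlim
  exact (dist_triangle _ (z.1 • X) _).trans
    (add_le_add (dist_smul_smul_le z.1 z.2 X) (dist_smul_le hC z.1 t))

/-- Convex bodies are approximated from outside by polytopes. -/
theorem exists_halfspaceInter_near [FiniteDimensional ℝ V] (X : ConvexBody V) {ε : ℝ}
    (hε : 0 < ε) : ∃ s : List (V →ᵃ[ℝ] ℝ), IsCompact (halfspaceInter s) ∧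
      (X : Set V) ⊆ halfspaceInter s ∧ halfspaceInter s ⊆ Metric.cthickening ε (X : Set V) := by
  have := FiniteDimensional.proper_real V
  have hthick : IsCompact (Metric.cthickening ε (X : Set V)) := X.isCompact.cthickening
  let S : Set V := {z | Metric.infDist z X = ε}
  have hScl : IsClosed S := isClosed_eq (Metric.continuous_infDist_pt _) continuous_const
  have hmem : ∀ z : V, Metric.infDist z X ≤ ε → z ∈ Metric.cthickening ε (X : Set V) := by
    intro z hz
    rw [Metric.cthickening_eq_preimage_infEDist, mem_preimage, mem_Iic,
      ← ENNReal.ofReal_toReal (Metric.infEDist_ne_top X.nonempty)]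
    exact ENNReal.ofReal_le_ofReal hz
  have hS : IsCompact S := hthick.of_isClosed_subset hScl fun z hz => hmem z (le_of_eq hz)
  -- Compactness of the level set at distance `ε` lets finitely many separating half-spaces avoid
  -- it. The resulting polytope is connected and meets `X`, so it cannot go beyond that level.
  obtain ⟨s, hXs, hdisj⟩ : ∃ s : List (V →ᵃ[ℝ] ℝ), (X : Set V) ⊆ halfspaceInter s ∧
      Disjoint S (halfspaceInter s) := by
    refine hS.induction_on (p := fun T => ∃ s : List (V →ᵃ[ℝ] ℝ),
      (X : Set V) ⊆ halfspaceInter s ∧ Disjoint T (halfspaceInter s)) ?_ ?_ ?_ ?_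
    · exact ⟨[], fun x _ g hg => by simp at hg, empty_disjoint _⟩
    · rintro T T' hT ⟨s, h1, h2⟩
      exact ⟨s, h1, h2.mono_left hT⟩
    · rintro T T' ⟨s, h1, h2⟩ ⟨s', h1', h2'⟩
      refine ⟨s ++ s', fun x hx g hg => ?_, ?_⟩
      · exact (List.mem_append.1 hg).elim (h1 hx g) (h1' hx g)
      · rw [disjoint_union_left]
        exact ⟨h2.mono_right fun x hx g hg => hx g (List.mem_append_left _ hg),
          h2'.mono_right (halfspaceInter_append_subset_right s s')⟩
    · intro z hz
      have hzX : z ∉ (X : Set V) := fun h => by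
        have h0 := Metric.infDist_zero_of_mem h
        rw [show Metric.infDist z X = ε from hz] at h0
        exact hε.ne' h0
      obtain ⟨f, u, hfu, huz⟩ := geometric_hahn_banach_closed_point X.convex X.isClosed hzX
      let g : V →ᵃ[ℝ] ℝ := AffineMap.const ℝ V u - (f : V →ₗ[ℝ] ℝ).toAffineMap
      have hg : ∀ x, g x = u - f x := fun x => rfl
      refine ⟨{x | g x < 0}, mem_nhdsWithin_of_mem_nhds ?_, [g], ?_, ?_⟩
      · refine (isOpen_lt g.continuous_of_finiteDimensional continuous_const).mem_nhds ?_
        change g z < 0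
        rw [hg]
        linarith
      · intro x hx g' hg'
        rw [List.mem_singleton.1 hg', hg]
        linarith [hfu x hx]
      · rw [disjoint_left]
        intro x hx hx'
        exact absurd (hx' g (by simp)) (not_le.2 hx)
  have hsub : halfspaceInter s ⊆ Metric.cthickening ε (X : Set V) := by
    intro y hy
    refine hmem y ?_
    by_contra! hlt
    obtain ⟨x, hx⟩ := X.nonempty
    obtain ⟨z, hz, hzε⟩ := (convex_halfspaceInter s).isPreconnected.intermediate_value (hXs hx) hy
      (Metric.continuous_infDist_pt (X : Set V)).continuousOn
      ⟨(Metric.infDist_zero_of_mem hx).le.trans hε.le, hlt.le⟩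
    exact disjoint_left.1 hdisj hzε hz
  exact ⟨s, hthick.of_isClosed_subset (isClosed_halfspaceInter s) hsub, hXs, hsub⟩

/-- A continuous valuation on a `d`-dimensional space which vanishes on convex hulls of `d + 1`
points is zero. -/
theorem IsValuation.eq_zero_of_hull {V : Type u} {A : Type v} [NormedAddCommGroup V]
    [NormedSpace ℝ V] [FiniteDimensional ℝ V] [AddCommGroup A] [TopologicalSpace A] [T1Space A]
    {ψ : ConvexBody V → A} (hψ : IsValuation ψ) (hc : Continuous ψ)
    (h0 : ∀ w : Fin (finrank ℝ V + 1) → V, ψ (hull w) = 0) (X : ConvexBody V) : ψ X = 0 := by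
  have hcl : IsClosed {Y | ψ Y = 0} := isClosed_singleton.preimage hc
  suffices X ∈ closure {Y | ψ Y = 0} from hcl.closure_subset this
  rw [Metric.mem_closure_iff]
  intro ε hε
  obtain ⟨s, hs, hXs, hsX⟩ := X.exists_halfspaceInter_near (half_pos hε)
  let P : ConvexBody V := ⟨halfspaceInter s, convex_halfspaceInter s, hs, X.nonempty.mono hXs⟩
  refine ⟨P, ?_, ?_⟩
  · have := hψ.isSetValuation.eq_zero_of_simplices (finrank ℝ V) rfl (fun w => ?_) s hs
    · exact (extend_coe ψ P).symm.trans this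
    · exact (extend_coe ψ (hull w)).trans (h0 w)
  · refine lt_of_le_of_lt ?_ (half_lt_self hε)
    refine Metric.hausdorffDist_le_of_mem_dist (half_pos hε).le (fun x hx => ?_) fun x hx => ?_
    · exact ⟨x, hXs hx, by simpa using (half_pos hε).le⟩
    · have := hsX hx
      rw [X.isCompact.cthickening_eq_biUnion_closedBall (half_pos hε).le] at this
      simpa using this

/-- The dilates of a convex body form a polynomial family under a translation-invariant
valuation. -/
theorem fwdDiff_smul_eq_zero {V : Type u} {A : Type v} [NormedAddCommGroup V] [NormedSpace ℝ V]
    [FiniteDimensional ℝ V] [AddCommGroup A] [TopologicalSpace A] [IsTopologicalAddGroup A]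
    [T2Space A] {φ : ConvexBody V → A} (hφ : IsValuation φ) (hinv : IsTranslationInvariant φ)
    (hc : Continuous φ) (h : ℝ≥0) :
    Δ_[h] ^[finrank ℝ V + 1] (fun (t : ℝ≥0) (X : ConvexBody V) => φ (t • X)) = 0 := by
  have hF : Continuous (uncurry fun (t : ℝ≥0) (X : ConvexBody V) => φ (t • X)) :=
    hc.comp continuous_smul_nnreal
  funext y X
  -- For fixed `h` and `y` the difference is a continuous valuation in `X`, so simplices suffice.
  refine IsValuation.eq_zero_of_hull
    (fwdDiff_iter_mem (S := invariantValuations V A)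
      (fun t => dilate_mem_invariantValuations hφ hinv t) h _ y).1 ?_ (fun w => ?_) X
  · exact (continuous_fwdDiff_iter hF (finrank ℝ V + 1)).comp
      (f := fun X : ConvexBody V => (h, y, X)) (by fun_prop)
  · have := fwdDiff_hull_eq_zero hφ hinv w h y
    rw [Fintype.card_fin, fwdDiff_iter_eq_sum_shift] at this
    rw [fwdDiff_iter_eq_sum_shift, Finset.sum_apply]
    exact this

end ConvexBody

end Dilation

/-! ### The topological vector space of one-parameter groups. -/

section OneParameter

open Function

variable {A : Type*} [AddCommGroup A] [TopologicalSpace A] [IsTopologicalAddGroup A]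

namespace ContinuousAddMonoidHom

/-- The multiplication of the parameter of a one-parameter group by a scalar. -/
def rescale (s : ℝ) (γ : ℝ →ₜ+ A) : ℝ →ₜ+ A where
  toFun t := γ (t * s)
  map_zero' := by simp
  map_add' a b := by rw [add_mul, map_add]
  continuous_toFun := γ.continuous_toFun.comp (continuous_mul_const s)

/-- The one-parameter groups of an abelian topological group form a real vector space. -/
instance oneParameterModule : Module ℝ (ℝ →ₜ+ A) where
  smul := rescale
  one_smul γ := ContinuousAddMonoidHom.ext fun t => congrArg γ (mul_one t)
  mul_smul r s γ := ContinuousAddMonoidHom.ext fun t => congrArg γ (by ring)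
  smul_zero r := ContinuousAddMonoidHom.ext fun t => rfl
  smul_add r γ δ := ContinuousAddMonoidHom.ext fun t => rfl
  add_smul r s γ := ContinuousAddMonoidHom.ext fun t =>
    (congrArg γ (mul_add t r s)).trans (map_add γ _ _)
  zero_smul γ := ContinuousAddMonoidHom.ext fun t => (congrArg γ (mul_zero t)).trans (map_zero γ)

instance : ContinuousSMul ℝ (ℝ →ₜ+ A) where
  continuous_smul := by
    refine continuous_of_continuous_uncurry _ ?_
    have : Continuous fun z : (ℝ × (ℝ →ₜ+ A)) × ℝ => z.1.2 (z.2 * z.1.1) := by fun_prop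
    exact this

end ContinuousAddMonoidHom

/-- A map into a real Hausdorff topological vector space factors through one which lives in the
universe of the source. -/
theorem exists_small_topologicalVectorSpace {X : Type u} {E : Type v} [AddCommGroup E] [Module ℝ E]
    [TopologicalSpace E] [IsTopologicalAddGroup E] [ContinuousSMul ℝ E] [T2Space E] (f : X → E) :
    ∃ (W : Type u) (_ : AddCommGroup W) (_ : Module ℝ W) (_ : TopologicalSpace W)
      (_ : IsTopologicalAddGroup W) (_ : ContinuousSMul ℝ W) (_ : T2Space W)
      (T : W →ₗ[ℝ] E) (k : X → W), Topology.IsEmbedding T ∧ ∀ x, T (k x) = f x := by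
  -- The span of the image of `f`, realized as a quotient of the free vector space on `X` to fix the
  -- universe, with the topology induced from `E`.
  let p : (X →₀ ℝ) →ₗ[ℝ] E := Finsupp.linearCombination ℝ f
  let W := (X →₀ ℝ) ⧸ LinearMap.ker p
  let T : W →ₗ[ℝ] E := (LinearMap.ker p).liftQ p le_rfl
  have hT : Injective T := LinearMap.ker_eq_bot.1 (Submodule.ker_liftQ_eq_bot _ _ _ le_rfl)
  let : TopologicalSpace W := TopologicalSpace.induced T inferInstance
  have hind : Topology.IsInducing T := ⟨rfl⟩
  have hemb : Topology.IsEmbedding T := ⟨hind, hT⟩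
  exact ⟨W, inferInstance, inferInstance, inferInstance, hind.topologicalAddGroup T,
    hind.continuousSMul continuous_id (map_smul T _ _), hemb.t2Space, T,
    fun x => Submodule.Quotient.mk (Finsupp.single x 1), hemb,
    fun x => (Submodule.liftQ_apply _ p _).trans (by simp [p])⟩

end OneParameter

/-! ### Conclusion. -/

theorem ConvexBody.point_eq_translate {V : Type*} [NormedAddCommGroup V] [NormedSpace ℝ V] (x : V) :
    point x = translate x (point 0) := by
  apply ConvexBody.ext
  change ({x} : Set V) = (fun y => x + y) '' {0}
  simp

theorem theoremA {V : Type u} [NormedAddCommGroup V] [NormedSpace ℝ V]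
    [FiniteDimensional ℝ V]
    {A : Type v} [AddCommGroup A] [TopologicalSpace A] [IsTopologicalAddGroup A] [T2Space A]
    (φ : ConvexBody V → A) (hcont : Continuous φ) (hval : ConvexBody.IsValuation φ)
    (hinv : ConvexBody.IsTranslationInvariant φ) :
    ∃ c : A, (∀ x : V, φ (ConvexBody.point x) = c) ∧
      ∃ (W : Type u) (_ : AddCommGroup W) (_ : Module ℝ W) (_ : TopologicalSpace W)
        (_ : IsTopologicalAddGroup W) (_ : ContinuousSMul ℝ W) (_ : T2Space W)
        (f : ConvexBody V → W) (g : W →ₜ+ A),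
        Continuous f ∧ ConvexBody.IsValuation f ∧ ConvexBody.IsTranslationInvariant f ∧
          ∀ X : ConvexBody V, φ X - c = g (f X) := by
  refine ⟨φ (ConvexBody.point 0), fun x => by rw [ConvexBody.point_eq_translate, hinv], ?_⟩
  obtain ⟨G, hGc, hGS, hG1⟩ := exists_oneParameter_of_fwdDiff_eq_zero (Module.finrank ℝ V)
    (ConvexBody.invariantValuations V A) (fun t X => φ (t • X))
    (hcont.comp ConvexBody.continuous_smul_nnreal)
    (fun t => ConvexBody.dilate_mem_invariantValuations hval hinv t)
    (fun h => ConvexBody.fwdDiff_smul_eq_zero hval hinv hcont h)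
  let Γ : ConvexBody V → (ℝ →ₜ+ A) := fun X =>
    { toFun := fun t => G t X
      map_zero' := by rw [map_zero]; rfl
      map_add' := fun s t => by rw [map_add]; rfl
      continuous_toFun := hGc.comp (f := fun t : ℝ => (t, X)) (by fun_prop) }
  -- Joint continuity of `G t X` gives continuity into the compact-open topology.
  have hΓc : Continuous Γ := ContinuousAddMonoidHom.continuous_of_continuous_uncurry _
    (hGc.comp continuous_swap)
  obtain ⟨W, _, _, _, _, _, _, T, f, hT, hTf⟩ := exists_small_topologicalVectorSpace Γ
  refine ⟨W, inferInstance, inferInstance, inferInstance, inferInstance, inferInstance,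
    inferInstance, f, ⟨{ toFun := fun x => T x 1, map_zero' := ?_, map_add' := ?_ }, ?_⟩,
    ?_, ?_, ?_, ?_⟩
  · rw [map_zero]; rfl
  · intro x y
    rw [map_add]; rfl
  · exact (continuous_eval_const (1 : ℝ)).comp hT.continuous
  · rw [hT.continuous_iff]
    exact hΓc.congr fun X => (hTf X).symm
  · intro B C U I hU hI
    apply hT.injective
    rw [map_sub, map_add, hTf, hTf, hTf, hTf]
    refine ContinuousAddMonoidHom.ext fun t => ?_
    exact (hGS t).1 B C U I hU hI
  · intro x K
    apply hT.injective
    rw [hTf, hTf]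
    exact ContinuousAddMonoidHom.ext fun t => (hGS t).2 x K
  · intro X
    change _ = T (f X) 1
    rw [hTf]
    change _ = G 1 X
    have h0 : (0 : ConvexBody V) = ConvexBody.point 0 := ConvexBody.ext rfl
    rw [hG1, Pi.sub_apply, one_smul, zero_smul, h0]
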